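/- Consider a platoon of $N\ge 2$ identical vehicles indexed $1,\dots,N$ (vehicle $1$ is the leader) with rational transfer function $R(s)=b(s)/a(s)$ and controller $C(s)=q(s)/p(s)$, both real rational functions in lowest terms, and open loop $M=RC$. The positions and external inputs satisfy $y=M(-Ly+r)$, where $L\in\mathbb R^{N\times N}$ is the path-graph Laplacian with zero first row, $i$-th row given by $L_{i,i-1}=-1$, $L_{i,i}=1+\varepsilon_i$, $L_{i,i+1}=-\varepsilon_i$ for $1<i<N$ (all other entries zero), and last row given by $L_{N,N-1}=-1$, $L_{N,N}=1$ (all other entries zero); the constants of bidirectionality satisfy $\varepsilon_i\ge 0$. Let $T_{c,o}(s)=y_o(s)/r_c(s)$ be the transfer functions of the platoon, and let $\|G\|_\infty=\sup_{\omega\ge 0}|G(\jmath\omega)|$. The platoon is called asymptotically stable if $\det\bigl(a(s)p(s)I+b(s)q(s)L'\bigr)$ has all its roots in the open left half-plane, where $L'$ is $L$ without the row and the column of the leader. It is called bidirectionally string-stable if, for an input $r_c$ at any vehicle $c$, $\|y_o/y_{o-1}\|_\infty=\|T_{c,o}/T_{c,o-1}\|_\infty\le 1$ for all $o>c$ and $\|y_{o-1}/y_o\|_\infty=\|T_{c,o-1}/T_{c,o}\|_\infty\le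 1$ for all $2\le o<c$ (with $0/0=0$ when vehicle $c$ has no influence ahead). **Lemma (design of a predecessor following controller).** Suppose that $M=RC$ has at least one integrator (a pole at $s=0$) and that, for some $N\ge2$ and some $\varepsilon_i\ge0$, the platoon with vehicle $R$ and controller $C$ is asymptotically stable and bidirectionally string-stable. Then for the same vehicle $R$ there is a predecessor following controller, that is, a controller $\tilde C$ such that the platoons with $\varepsilon_i=0$ for all $i$ are asymptotically stable for every number of vehicles and the closed loop $T=R\tilde C/(1+R\tilde C)$ satisfies $\|T\|_\infty=1$. In fact the nonzero (real) eigenvalues of $L$ have a positive lower bound, and for every such lower bound $\lambda_{\min}>0$ the scaled controller $\tilde C=\lambda_{\min}C$ has these properties. -/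

import Mathlib

open scoped ENNReal Polynomial

noncomputable section

/-- The norm `sup_{ω ≥ 0} |G(jω)|` of a real rational transfer function, with values in `[0, ∞]`.
At a pole on the imaginary axis `RatFunc.eval` returns `0`, which does not matter:
`|G|` is unbounded near such a pole, so the supremum is `∞`. -/
def hinfNorm (G : RatFunc ℝ) : ℝ≥0∞ :=
  ⨆ (ω : ℝ) (_ : 0 ≤ ω), ‖G.eval (algebraMap ℝ ℂ) ((ω : ℂ) * Complex.I)‖ₑ

/-- The number of integrators of `G`: the order of the pole of `G` at `s = 0`, that is, the least
`η` for which `s ^ η * G(s)` is finite at `0`. (`G.denom` is the denominator in lowest terms.) -/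
def numIntegrators (G : RatFunc ℝ) : ℕ :=
  G.denom.rootMultiplicity 0

/-- The standard closed loop `G / (1 + G)` of an open loop `G`. -/
def closedLoop (G : RatFunc ℝ) : RatFunc ℝ :=
  G / (1 + G)

/-- The Laplacian of a platoon of `n + 1` vehicles: index `0` is the leader, indices `1, …, n`
are the followers, `Fin.last n` is the trailing vehicle, and `ε i` is the constant of
bidirectionality of vehicle `i` (not used for the leader and for the trailing vehicle). -/
def platoonLaplacian (n : ℕ) (ε : Fin (n + 1) → ℝ) : Matrix (Fin (n + 1)) (Fin (n + 1)) ℝ :=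
  Matrix.of fun i j =>
    if i = 0 then 0
    else if (j : ℕ) + 1 = i then -1
    else if j = i then (if i = Fin.last n then 1 else 1 + ε i)
    else if (j : ℕ) = i + 1 then -ε i
    else 0

/-- The Laplacian with the row and the column of the leader deleted. -/
def reducedLaplacian (n : ℕ) (ε : Fin (n + 1) → ℝ) : Matrix (Fin n) (Fin n) ℝ :=
  (platoonLaplacian n ε).submatrix Fin.succ Fin.succ

/-- The transfer matrix `T(s)` of the platoon with vehicle `R` and controller `K`: the control law
is `e = -L y + r` and the vehicles obey `y = R K e`, hence `(I + R K L) y = R K r`.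
The entry `(o, c)` is the transfer function from the input `r_c` to the output `y_o`. -/
def transferMatrix (R K : RatFunc ℝ) (n : ℕ) (ε : Fin (n + 1) → ℝ) :
    Matrix (Fin (n + 1)) (Fin (n + 1)) (RatFunc ℝ) :=
  (R * K) • (1 + (R * K) • (platoonLaplacian n ε).map (algebraMap ℝ (RatFunc ℝ)))⁻¹

/-- The characteristic polynomial `det (a p I + b q L')` of the followers of the platoon, where
`R = b / a` and `K = q / p` in lowest terms and `L'` is the reduced Laplacian.
Factors that cancel between the vehicle and the controller are kept. -/
def platoonCharpoly (R K : RatFunc ℝ) (n : ℕ) (ε : Fin (n + 1) → ℝ) : ℝ[X] :=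
  ((R.denom * K.denom) • (1 : Matrix (Fin n) (Fin n) ℝ[X]) +
    (R.num * K.num) • (reducedLaplacian n ε).map (Polynomial.C : ℝ → ℝ[X])).det

/-- Asymptotic stability of the platoon (the leader, which drives independently, is excluded):
all roots of the characteristic polynomial lie in the open left half-plane. -/
def PlatoonStable (R K : RatFunc ℝ) (n : ℕ) (ε : Fin (n + 1) → ℝ) : Prop :=
  ∀ z : ℂ, Polynomial.aeval z (platoonCharpoly R K n ε) = 0 → z.re < 0

/-- Bidirectional string stability, for an input at any vehicle `c`. Here the consecutive vehicles
`o - 1` and `o` are `k.castSucc` and `k.succ`: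
`‖y_o / y_{o-1}‖_∞ ≤ 1` for `o > c` and `‖y_{o-1} / y_o‖_∞ ≤ 1` for `o < c`.
(If vehicle `c` does not influence the vehicles ahead of it, the second ratio is `0 / 0 = 0`.) -/
def BidirectionallyStringStable (R K : RatFunc ℝ) (n : ℕ) (ε : Fin (n + 1) → ℝ) : Prop :=
  ∀ (c : Fin (n + 1)) (k : Fin n),
    (c < k.succ →
      hinfNorm (transferMatrix R K n ε k.succ c / transferMatrix R K n ε k.castSucc c) ≤ 1) ∧
    (k.succ < c →
      hinfNorm (transferMatrix R K n ε k.castSucc c / transferMatrix R K n ε k.succ c) ≤ 1)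

/-- `lam` is a positive lower bound of the nonzero eigenvalues of the Laplacian. -/
def IsEigenvalueLowerBound (n : ℕ) (ε : Fin (n + 1) → ℝ) (lam : ℝ) : Prop :=
  0 < lam ∧
    ∀ μ : ℝ, Module.End.HasEigenvalue (Matrix.toLin' (platoonLaplacian n ε)) μ → μ ≠ 0 → lam ≤ μ

/-- With the vehicle `R`, the controller `K` makes predecessor-following platoons (all constants
of bidirectionality zero) of every length asymptotically stable, and its closed loop
`R K / (1 + R K)` has norm exactly one. -/
def AchievesPredecessorFollowing (R K : RatFunc ℝ) : Prop :=
  (∀ m : ℕ, PlatoonStable R K m (fun _ => 0)) ∧ hinfNorm (closedLoop (R * K)) = 1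

end

/-!
With an input at the leader, the trailing vehicle follows its predecessor with ratio
`T = M / (1 + M)`, so string stability gives `‖T‖_∞ ≤ 1`: writing `M = B / A` with
`A = R.denom * K.denom` and `B = R.num * K.num`, `|B| ≤ |A + B|` on the imaginary axis. By the
triangle inequality `|t B| ≤ |A + t B|` there for all `0 ≤ t ≤ 1`.

The Laplacian has an eigenvalue `0 < μ ≤ 1`: the entries of an eigenvector, computed from the rear
of the platoon, are polynomials in the eigenvalue whose first positive zeros do not increase towards
the leader, and the first of these zeros is `1`. Its mode polynomial `A + μ B` divides the
characteristic polynomial of the platoon, hence is Hurwitz, and by the Phragmén–Lindelöf principle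
applied to `μ B / (A + μ B)` the bound `|μ B| ≤ |A + μ B|` extends from the axis to the closed right
half-plane. For `0 < λ ≤ μ` a zero of `A + λ B` in that half-plane would therefore be a common zero
of `A` and `B`, hence of `A + μ B`, which is impossible; so `A + λ B`, the mode polynomial of
the predecessor following platoon with controller `λ K`, is Hurwitz. Finally, an integrator forces
the closed loop to equal `1` at `s = 0`, so its norm is exactly `1`.
-/

section Polynomial

open Asymptotics Bornology Filter

theorem degree_le_of_isBigO_comp {𝕜 α : Type*} [NormedField 𝕜] {l : Filter α} [l.NeBot]
    {φ : α → 𝕜} (hφ : Tendsto φ l (cobounded 𝕜)) {p q : 𝕜[X]}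
    (h : (fun t => p.eval (φ t)) =O[l] fun t => q.eval (φ t)) : p.degree ≤ q.degree := by
  by_contra! hlt
  have hp : ∀ᶠ t in l, p.eval (φ t) ≠ 0 :=
    (hφ.mono_right (Bornology.le_cofinite 𝕜)).eventually
      (Polynomial.eventually_cofinite_not_isRoot (Polynomial.ne_zero_of_degree_gt hlt))
  exact isLittleO_irrefl hp.frequently
    (h.trans_isLittleO ((Polynomial.isLittleO_cobounded_of_degree_lt hlt).comp_tendsto hφ))

theorem tendsto_mul_I_cobounded :
    Tendsto (fun ω : ℝ => (ω : ℂ) * Complex.I) atTop (cobounded ℂ) :=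
  tendsto_norm_atTop_iff_cobounded.1 (by simpa using tendsto_abs_atTop_atTop)

theorem norm_eval_le_of_norm_eval_axis_le {p q : ℂ[X]}
    (hq : ∀ z : ℂ, 0 ≤ z.re → q.eval z ≠ 0)
    (haxis : ∀ ω : ℝ, ‖p.eval ((ω : ℂ) * Complex.I)‖ ≤ ‖q.eval ((ω : ℂ) * Complex.I)‖)
    {z : ℂ} (hz : 0 ≤ z.re) : ‖p.eval z‖ ≤ ‖q.eval z‖ := by
  have hdeg : p.degree ≤ q.degree :=
    degree_le_of_isBigO_comp tendsto_mul_I_cobounded (.of_bound' (.of_forall haxis))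
  have hbdd : (fun z => p.eval z / q.eval z) =O[cobounded ℂ] fun _ => (1 : ℝ) := by
    obtain ⟨C, hC0, hC⟩ := (Polynomial.isBigO_cobounded_of_degree_le hdeg).exists_nonneg
    refine .of_bound C (hC.bound.mono fun z hz => ?_)
    rw [norm_div, norm_one, mul_one]
    exact div_le_of_le_mul₀ (norm_nonneg _) hC0 hz
  have hquot : ‖p.eval z / q.eval z‖ ≤ 1 := by
    refine PhragmenLindelof.right_half_plane_of_bounded_on_real
      (f := fun z => p.eval z / q.eval z) ?_ ⟨0, two_pos, 0, ?_⟩ ?_ (fun ω => ?_) hz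
    · refine DifferentiableOn.diffContOnCl (p.differentiable.differentiableOn.div
        q.differentiable.differentiableOn fun z hz => hq z ?_)
      rwa [Complex.closure_setOfPred_lt_re] at hz
    · simpa using hbdd.mono inf_le_left
    · exact (hbdd.comp_tendsto
        (tendsto_norm_atTop_iff_cobounded.1 (by simpa using tendsto_abs_atTop_atTop) :
          Tendsto (fun x : ℝ => (x : ℂ)) atTop (cobounded ℂ))).isBoundedUnder_le
    · rw [norm_div]
      exact div_le_one_of_le₀ (haxis ω) (norm_nonneg _)
  rwa [norm_div, div_le_one (norm_pos_iff.2 (hq z hz))] at hquot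

theorem norm_smul_le_norm_add_smul {E : Type*} [SeminormedAddCommGroup E] [NormedSpace ℝ E]
    {a b : E} {s t : ℝ} (ht : 0 ≤ t) (hts : t ≤ s) (h : ‖s • b‖ ≤ ‖a + s • b‖) :
    ‖t • b‖ ≤ ‖a + t • b‖ := by
  have hsplit : ‖a + s • b‖ ≤ ‖a + t • b‖ + ‖(s - t) • b‖ := by
    simpa [sub_smul] using norm_add_le (a + t • b) ((s - t) • b)
  rw [norm_smul_of_nonneg (ht.trans hts)] at h
  rw [norm_smul_of_nonneg (sub_nonneg.2 hts)] at hsplit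
  rw [norm_smul_of_nonneg ht]
  linarith

/-- A Hurwitz polynomial: all complex roots lie in the open left half-plane. -/
def IsHurwitz (p : ℝ[X]) : Prop :=
  ∀ z : ℂ, Polynomial.aeval z p = 0 → z.re < 0

namespace IsHurwitz

variable {p q : ℝ[X]}

theorem ne_zero (hp : IsHurwitz p) : p ≠ 0 := by
  rintro rfl
  simpa using hp 0 (map_zero _)

theorem of_dvd (hq : IsHurwitz q) (hpq : p ∣ q) : IsHurwitz p := fun z hz =>
  hq z (zero_dvd_iff.1 (hz ▸ map_dvd (Polynomial.aeval z) hpq))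

theorem pow (hp : IsHurwitz p) (n : ℕ) : IsHurwitz (p ^ n) := fun z hz =>
  hp z (eq_zero_of_pow_eq_zero (by rwa [map_pow] at hz))

theorem norm_aeval_le_of_norm_aeval_axis_le (hq : IsHurwitz q)
    (haxis : ∀ ω : ℝ, ‖Polynomial.aeval ((ω : ℂ) * Complex.I) p‖ ≤
      ‖Polynomial.aeval ((ω : ℂ) * Complex.I) q‖) {z : ℂ} (hz : 0 ≤ z.re) :
    ‖Polynomial.aeval z p‖ ≤ ‖Polynomial.aeval z q‖ := by
  simp only [← Polynomial.eval_map_algebraMap] at haxis ⊢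
  refine norm_eval_le_of_norm_eval_axis_le (fun w hw h0 => ?_) haxis hz
  rw [Polynomial.eval_map_algebraMap] at h0
  exact (hq w h0).not_ge hw

theorem add_smul_of_le {s t : ℝ} (h : IsHurwitz (p + s • q)) (ht : 0 < t) (hts : t ≤ s)
    (haxis : ∀ ω : ℝ, ‖Polynomial.aeval ((ω : ℂ) * Complex.I) (s • q)‖ ≤
      ‖Polynomial.aeval ((ω : ℂ) * Complex.I) (p + s • q)‖) :
    IsHurwitz (p + t • q) := by
  intro z hz
  by_contra! hre
  have hle := h.norm_aeval_le_of_norm_aeval_axis_le haxis hre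
  simp only [map_add, map_smul] at hle hz
  have hq : Polynomial.aeval z q = 0 := by
    have hnorm := norm_smul_le_norm_add_smul ht.le hts hle
    rw [hz, norm_zero, norm_le_zero_iff, smul_eq_zero] at hnorm
    exact hnorm.resolve_left ht.ne'
  have hp : Polynomial.aeval z p = 0 := by simpa [hq] using hz
  exact (h z (by simp [hp, hq])).not_ge hre

end IsHurwitz

end Polynomial

section RationalFunction

universe u

theorem eval_algebraMap_div_algebraMap {F E : Type u} [Field F] [Field E] [Algebra F E]
    (p : F[X]) {q : F[X]} {z : E} (hq : Polynomial.aeval z q ≠ 0) :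
    (algebraMap F[X] (RatFunc F) p / algebraMap F[X] (RatFunc F) q).eval (algebraMap F E) z =
      Polynomial.aeval z p / Polynomial.aeval z q := by
  set G := algebraMap F[X] (RatFunc F) p / algebraMap F[X] (RatFunc F) q with hG
  have hdenom : Polynomial.aeval z G.denom ≠ 0 := fun h0 =>
    hq (zero_dvd_iff.1 (h0 ▸ map_dvd (Polynomial.aeval z) (RatFunc.denom_div_dvd p q)))
  have hcross : G.num * q = p * G.denom :=
    (RatFunc.num_mul_eq_mul_denom_iff (by rintro rfl; simp at hq)).2 hG
  rw [RatFunc.eval, ← Polynomial.aeval_def, ← Polynomial.aeval_def, div_eq_div_iff hdenom hq,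
    ← map_mul, ← map_mul, hcross]

theorem denom_C_mul {F : Type*} [Field F] (G : RatFunc F) {t : F} (ht : t ≠ 0) :
    (RatFunc.C t * G).denom = G.denom := by
  have hdvd (G : RatFunc F) (t : F) : (RatFunc.C t * G).denom ∣ G.denom := by
    simpa using RatFunc.denom_mul_dvd (RatFunc.C t) G
  refine Polynomial.eq_of_monic_of_associated (RatFunc.monic_denom _) (RatFunc.monic_denom _)
    (associated_of_dvd_dvd (hdvd G t) ?_)
  simpa [← mul_assoc, ← map_mul, ht] using hdvd (RatFunc.C t * G) t⁻¹

theorem num_C_mul {F : Type*} [Field F] (G : RatFunc F) {t : F} (ht : t ≠ 0) :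
    (RatFunc.C t * G).num = t • G.num := by
  have h := RatFunc.num_denom_mul (RatFunc.C t) G
  rw [denom_C_mul G ht, RatFunc.num_C, RatFunc.denom_C, one_mul] at h
  rw [mul_right_cancel₀ G.denom_ne_zero h, Polynomial.smul_eq_C_mul]

theorem mul_eq_num_mul_num_div {F : Type*} [Field F] (G H : RatFunc F) :
    G * H = algebraMap F[X] (RatFunc F) (G.num * H.num) /
      algebraMap F[X] (RatFunc F) (G.denom * H.denom) := by
  rw [map_mul, map_mul, ← div_mul_div_comm, RatFunc.num_div_denom, RatFunc.num_div_denom]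

theorem closedLoop_div (p : ℝ[X]) {q : ℝ[X]} (hq : q ≠ 0) :
    closedLoop (algebraMap ℝ[X] (RatFunc ℝ) p / algebraMap ℝ[X] (RatFunc ℝ) q) =
      algebraMap ℝ[X] (RatFunc ℝ) p / algebraMap ℝ[X] (RatFunc ℝ) (q + p) := by
  have hq' : algebraMap ℝ[X] (RatFunc ℝ) q ≠ 0 := RatFunc.algebraMap_ne_zero hq
  rw [closedLoop, one_add_div hq', div_div_div_cancel_right₀ hq', map_add]

theorem closedLoop_eq_num_div (G : RatFunc ℝ) :
    closedLoop G = algebraMap ℝ[X] (RatFunc ℝ) G.num /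
      algebraMap ℝ[X] (RatFunc ℝ) (G.denom + G.num) := by
  rw [← closedLoop_div _ G.denom_ne_zero, RatFunc.num_div_denom]

theorem closedLoop_mul (R K : RatFunc ℝ) :
    closedLoop (R * K) = algebraMap ℝ[X] (RatFunc ℝ) (R.num * K.num) /
      algebraMap ℝ[X] (RatFunc ℝ) (R.denom * K.denom + R.num * K.num) := by
  rw [← closedLoop_div _ (mul_ne_zero R.denom_ne_zero K.denom_ne_zero), ← mul_eq_num_mul_num_div]

theorem numIntegrators_C_mul (G : RatFunc ℝ) {t : ℝ} (ht : t ≠ 0) :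
    numIntegrators (RatFunc.C t * G) = numIntegrators G := by
  rw [numIntegrators, denom_C_mul G ht, numIntegrators]

theorem eval_zero_closedLoop {G : RatFunc ℝ} (h : 1 ≤ numIntegrators G) :
    (closedLoop G).eval (algebraMap ℝ ℂ) 0 = 1 := by
  have hdenom : Polynomial.aeval (0 : ℂ) G.denom = 0 := by
    have hroot : G.denom.IsRoot 0 := (Polynomial.rootMultiplicity_pos G.denom_ne_zero).1 h
    simpa [hroot.eq_zero] using Polynomial.aeval_algebraMap_apply ℂ (0 : ℝ) G.denom
  have hnum : Polynomial.aeval (0 : ℂ) G.num ≠ 0 :=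
    (Polynomial.aeval_ne_zero_of_isCoprime G.isCoprime_num_denom 0).resolve_right (by simp [hdenom])
  have hsum : Polynomial.aeval (0 : ℂ) (G.denom + G.num) = Polynomial.aeval 0 G.num := by
    rw [map_add, hdenom, zero_add]
  rw [closedLoop_eq_num_div, eval_algebraMap_div_algebraMap _ (hsum ▸ hnum), hsum, div_self hnum]

theorem closedLoop_ne_zero {G : RatFunc ℝ} (h : 1 ≤ numIntegrators G) : closedLoop G ≠ 0 := by
  intro h0
  simpa [h0] using eval_zero_closedLoop h

end RationalFunction

section HinfNorm

theorem enorm_eval_axis_le_hinfNorm (G : RatFunc ℝ) {ω : ℝ} (hω : 0 ≤ ω) :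
    ‖G.eval (algebraMap ℝ ℂ) ((ω : ℂ) * Complex.I)‖ₑ ≤ hinfNorm G :=
  le_iSup₂_of_le ω hω le_rfl

theorem one_le_hinfNorm_closedLoop {G : RatFunc ℝ} (h : 1 ≤ numIntegrators G) :
    1 ≤ hinfNorm (closedLoop G) := by
  simpa [eval_zero_closedLoop h] using enorm_eval_axis_le_hinfNorm (closedLoop G) le_rfl

theorem hinfNorm_div_le_one {p q : ℝ[X]}
    (hq : ∀ ω : ℝ, Polynomial.aeval ((ω : ℂ) * Complex.I) q ≠ 0)
    (h : ∀ ω : ℝ, ‖Polynomial.aeval ((ω : ℂ) * Complex.I) p‖ ≤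
      ‖Polynomial.aeval ((ω : ℂ) * Complex.I) q‖) :
    hinfNorm (algebraMap ℝ[X] (RatFunc ℝ) p / algebraMap ℝ[X] (RatFunc ℝ) q) ≤ 1 := by
  refine iSup₂_le fun ω _ => ?_
  rw [eval_algebraMap_div_algebraMap p (hq ω), ← ofReal_norm, norm_div]
  exact ENNReal.ofReal_le_one.2 (div_le_one_of_le₀ (h ω) (norm_nonneg _))

theorem norm_aeval_abs_mul_I (p : ℝ[X]) (ω : ℝ) :
    ‖Polynomial.aeval (((|ω| : ℝ) : ℂ) * Complex.I) p‖ =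
      ‖Polynomial.aeval ((ω : ℂ) * Complex.I) p‖ := by
  obtain hω | hω := abs_choice ω
  · rw [hω]
  · have hconj : ((|ω| : ℝ) : ℂ) * Complex.I = Complex.conjAe ((ω : ℂ) * Complex.I) := by
      simp [hω]
    rw [hconj, Polynomial.aeval_algHom_apply, Complex.conjAe_coe, RCLike.norm_conj]

theorem dense_setOf_aeval_mul_I_ne_zero {q : ℝ[X]} (hq : q ≠ 0) :
    Dense {ω : ℝ | Polynomial.aeval ((ω : ℂ) * Complex.I) q ≠ 0} := by
  have hinj : Function.Injective fun ω : ℝ => (ω : ℂ) * Complex.I :=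
    (mul_left_injective₀ Complex.I_ne_zero).comp Complex.ofReal_injective
  have hfin : {ω : ℝ | Polynomial.aeval ((ω : ℂ) * Complex.I) q = 0}.Finite :=
    ((q.rootSet_finite ℂ).preimage hinj.injOn).subset fun ω hω =>
      Polynomial.mem_rootSet.2 ⟨hq, hω⟩
  exact hfin.countable.dense_compl ℝ

theorem norm_aeval_axis_le_of_hinfNorm_div_le_one {p q : ℝ[X]} (hq : q ≠ 0)
    (h : hinfNorm (algebraMap ℝ[X] (RatFunc ℝ) p / algebraMap ℝ[X] (RatFunc ℝ) q) ≤ 1) (ω : ℝ) :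
    ‖Polynomial.aeval ((ω : ℂ) * Complex.I) p‖ ≤ ‖Polynomial.aeval ((ω : ℂ) * Complex.I) q‖ := by
  have hclosed : IsClosed {ω : ℝ | ‖Polynomial.aeval ((ω : ℂ) * Complex.I) p‖ ≤
      ‖Polynomial.aeval ((ω : ℂ) * Complex.I) q‖} :=
    isClosed_le (by fun_prop) (by fun_prop)
  refine hclosed.closure_subset_iff.2 (fun ω hω => ?_) (dense_setOf_aeval_mul_I_ne_zero hq ω)
  have hpos : 0 < ‖Polynomial.aeval (((|ω| : ℝ) : ℂ) * Complex.I) q‖ := by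
    rw [norm_aeval_abs_mul_I]
    exact norm_pos_iff.2 hω
  have hle := (enorm_eval_axis_le_hinfNorm _ (abs_nonneg ω)).trans h
  rw [eval_algebraMap_div_algebraMap p (norm_pos_iff.1 hpos), ← ofReal_norm,
    ENNReal.ofReal_le_one, norm_div, div_le_one hpos] at hle
  rwa [norm_aeval_abs_mul_I, norm_aeval_abs_mul_I] at hle

end HinfNorm

section TrailingContinuant

/-- The displacement of the `k`-th vehicle from the rear in an eigenvector of the Laplacian,
relative to the trailing vehicle, as a polynomial in the eigenvalue. Here `e k` is the constant of
bidirectionality of the vehicle with `k + 1` vehicles behind it. -/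
noncomputable def trailingContinuant (e : ℕ → ℝ) : ℕ → ℝ[X]
  | 0 => 1
  | 1 => 1 - Polynomial.X
  | k + 2 => (1 + Polynomial.C (e k) - Polynomial.X) * trailingContinuant e (k + 1) -
      Polynomial.C (e k) * trailingContinuant e k

theorem eval_zero_trailingContinuant (e : ℕ → ℝ) (k : ℕ) :
    (trailingContinuant e k).eval 0 = 1 := by
  induction k using Nat.twoStepInduction with
  | zero => simp [trailingContinuant]
  | one => simp [trailingContinuant]
  | more k h0 h1 => simp [trailingContinuant, h0, h1]

theorem one_le_eval_trailingContinuant {e : ℕ → ℝ} (he : ∀ k, 0 ≤ e k) {x : ℝ} (hx : x ≤ 0)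
    (k : ℕ) : 1 ≤ (trailingContinuant e k).eval x := by
  suffices h : 1 ≤ (trailingContinuant e k).eval x ∧
      (trailingContinuant e k).eval x ≤ (trailingContinuant e (k + 1)).eval x from h.1
  induction k with
  | zero => simp [trailingContinuant, hx]
  | succ k ih =>
    obtain ⟨hone, hmono⟩ := ih
    refine ⟨hone.trans hmono, ?_⟩
    simp only [trailingContinuant, Polynomial.eval_sub, Polynomial.eval_mul, Polynomial.eval_add,
      Polynomial.eval_one, Polynomial.eval_C, Polynomial.eval_X]
    nlinarith [mul_nonneg (he k) (sub_nonneg.2 hmono),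
      mul_nonneg (neg_nonneg.2 hx) (zero_le_one.trans (hone.trans hmono))]

theorem exists_first_zero {α β : Type*} [ConditionallyCompleteLinearOrder α] [TopologicalSpace α]
    [OrderTopology α] [DenselyOrdered α] [LinearOrder β] [TopologicalSpace β]
    [OrderClosedTopology β] [Zero β] {f : α → β} {a b : α} (hf : ContinuousOn f (Set.Icc a b))
    (hab : a ≤ b) (ha : 0 < f a) (hb : f b ≤ 0) :
    ∃ z ∈ Set.Ioc a b, f z = 0 ∧ ∀ y ∈ Set.Icc a z, 0 ≤ f y := by
  have hcompact : IsCompact (Set.Icc a b ∩ f ⁻¹' {0}) :=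
    isCompact_Icc.of_isClosed_subset (hf.preimage_isClosed_of_isClosed isClosed_Icc
      isClosed_singleton) Set.inter_subset_left
  obtain ⟨z, ⟨hz, hfz : f z = 0⟩, hmin⟩ :=
    hcompact.exists_isLeast (intermediate_value_Icc' hab hf ⟨hb, ha.le⟩)
  have haz : a < z := hz.1.lt_of_ne (by rintro rfl; exact ha.ne' hfz)
  refine ⟨z, ⟨haz, hz.2⟩, hfz, fun y hy => ?_⟩
  by_contra! hneg
  obtain ⟨w, hw, hfw⟩ := intermediate_value_Icc' hy.1
    (hf.mono (Set.Icc_subset_Icc_right (hy.2.trans hz.2))) ⟨hneg.le, ha.le⟩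
  have hzw : z ≤ w := hmin ⟨⟨hw.1, hw.2.trans (hy.2.trans hz.2)⟩, hfw⟩
  rw [le_antisymm hy.2 (hzw.trans hw.2), hfz] at hneg
  exact hneg.false

theorem exists_isRoot_trailingContinuant {e : ℕ → ℝ} (he : ∀ k, 0 ≤ e k) (k : ℕ) :
    ∃ x ∈ Set.Ioc (0 : ℝ) 1, (trailingContinuant e (k + 1)).IsRoot x := by
  -- At the first root of one continuant the next one is nonpositive, so its first root comes no
  -- later.
  suffices h : ∃ x ∈ Set.Ioc (0 : ℝ) 1, (trailingContinuant e (k + 1)).IsRoot x ∧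
      ∀ y ∈ Set.Icc 0 x, 0 ≤ (trailingContinuant e k).eval y ∧
        0 ≤ (trailingContinuant e (k + 1)).eval y by
    obtain ⟨x, hx, hroot, -⟩ := h
    exact ⟨x, hx, hroot⟩
  induction k with
  | zero =>
    refine ⟨1, ⟨one_pos, le_rfl⟩, by simp [trailingContinuant], fun y hy => ?_⟩
    simpa [trailingContinuant] using hy.2
  | succ k ih =>
    obtain ⟨x, ⟨hx0, hx1⟩, hroot, hnonneg⟩ := ih
    have hle : (trailingContinuant e (k + 2)).eval x ≤ 0 := by
      simpa [trailingContinuant, hroot.eq_zero] using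
        mul_nonneg (he k) (hnonneg x ⟨hx0.le, le_rfl⟩).1
    obtain ⟨z, ⟨hz0, hzx⟩, hz, hznonneg⟩ := exists_first_zero
      (trailingContinuant e (k + 2)).continuousOn hx0.le
      (by simp [eval_zero_trailingContinuant]) hle
    exact ⟨z, ⟨hz0, hzx.trans hx1⟩, hz, fun y hy =>
      ⟨(hnonneg y ⟨hy.1, hy.2.trans hzx⟩).2, hznonneg y hy⟩⟩

end TrailingContinuant

section LaplacianSpectrum

open Matrix

variable {n : ℕ} {ε : Fin (n + 1) → ℝ}

theorem platoonLaplacian_zero (n : ℕ) (ε : Fin (n + 1) → ℝ) : platoonLaplacian n ε 0 = 0 := by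
  ext j
  simp [platoonLaplacian]

theorem platoonLaplacian_interior (ε : Fin (n + 1) → ℝ) {i : ℕ} (hi : i + 2 ≤ n) :
    platoonLaplacian n ε ⟨i + 1, by lia⟩ =
      Pi.single ⟨i + 1, by lia⟩ (1 + ε ⟨i + 1, by lia⟩) - Pi.single ⟨i, by lia⟩ 1 -
        Pi.single ⟨i + 2, by lia⟩ (ε ⟨i + 1, by lia⟩) := by
  ext j
  simp only [platoonLaplacian, Matrix.of_apply, Fin.ext_iff, Fin.val_last, Fin.val_zero,
    Pi.sub_apply, Pi.single_apply]
  grind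

theorem platoonLaplacian_last (m : ℕ) (ε : Fin (m + 2) → ℝ) :
    platoonLaplacian (m + 1) ε (Fin.last (m + 1)) =
      Pi.single (Fin.last (m + 1)) 1 - Pi.single (Fin.last m).castSucc 1 := by
  ext j
  simp only [platoonLaplacian, Matrix.of_apply, Fin.ext_iff, Fin.val_last, Fin.val_zero,
    Fin.val_castSucc, Pi.sub_apply, Pi.single_apply]
  grind

variable {S : Type*} [CommRing S] [Algebra ℝ S]

theorem platoonLaplacian_mulVec_zero (v : Fin (n + 1) → S) :
    ((platoonLaplacian n ε).map (algebraMap ℝ S) *ᵥ v) 0 = 0 := by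
  simp [mulVec, dotProduct, platoonLaplacian_zero]

theorem platoonLaplacian_mulVec_interior (v : Fin (n + 1) → S) {i : ℕ} (hi : i + 2 ≤ n) :
    ((platoonLaplacian n ε).map (algebraMap ℝ S) *ᵥ v) ⟨i + 1, by lia⟩ =
      (1 + algebraMap ℝ S (ε ⟨i + 1, by lia⟩)) * v ⟨i + 1, by lia⟩ - v ⟨i, by lia⟩ -
        algebraMap ℝ S (ε ⟨i + 1, by lia⟩) * v ⟨i + 2, by lia⟩ := by
  simp [mulVec, dotProduct, platoonLaplacian_interior ε hi, Pi.single_apply, sub_mul,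
    Finset.sum_sub_distrib, apply_ite (algebraMap ℝ S)]

theorem platoonLaplacian_mulVec_last {m : ℕ} {ε : Fin (m + 2) → ℝ} (v : Fin (m + 2) → S) :
    ((platoonLaplacian (m + 1) ε).map (algebraMap ℝ S) *ᵥ v) (Fin.last (m + 1)) =
      v (Fin.last (m + 1)) - v (Fin.last m).castSucc := by
  simp [mulVec, dotProduct, platoonLaplacian_last, Pi.single_apply, sub_mul,
    Finset.sum_sub_distrib, apply_ite (algebraMap ℝ S)]

/-- The constants of bidirectionality of the interior vehicles, counted from the rear; the values
at `k + 1 ≥ n` are irrelevant. -/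
def rearConstants (n : ℕ) (ε : Fin (n + 1) → ℝ) (k : ℕ) : ℝ :=
  ε (Fin.ofNat (n + 1) (n - 1 - k))

theorem rearConstants_of_add_eq (ε : Fin (n + 1) → ℝ) {i k : ℕ} (h : i + (k + 2) = n) :
    rearConstants n ε k = ε ⟨i + 1, by lia⟩ := by
  unfold rearConstants
  congr 1
  ext
  rw [Fin.val_ofNat, Nat.mod_eq_of_lt] <;> lia

theorem eq_aeval_trailingContinuant_mul_last {x : S} {v : Fin (n + 1) → S}
    (hv : ∀ i : Fin n,
      ((platoonLaplacian n ε).map (algebraMap ℝ S) *ᵥ v) i.succ = x * v i.succ)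
    {i k : ℕ} (h : i + k = n) :
    v ⟨i, by lia⟩ =
      Polynomial.aeval x (trailingContinuant (rearConstants n ε) k) * v (Fin.last n) := by
  induction k using Nat.twoStepInduction generalizing i with
  | zero =>
    subst h
    simp [trailingContinuant, Fin.last]
  | one =>
    subst h
    have hrow := hv (Fin.last i)
    rw [Fin.succ_last, platoonLaplacian_mulVec_last] at hrow
    have hi : (⟨i, by lia⟩ : Fin (i + 2)) = (Fin.last i).castSucc := rfl
    simp only [trailingContinuant, map_sub, map_one, Polynomial.aeval_X, hi]
    linear_combination -hrow
  | more k ih₀ ih₁ =>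
    have hrow := hv ⟨i, by lia⟩
    rw [Fin.succ_mk, platoonLaplacian_mulVec_interior v (by lia), ih₀ (i := i + 2) (by lia),
      ih₁ (i := i + 1) (by lia)] at hrow
    simp only [trailingContinuant, map_sub, map_add, map_mul, map_one, Polynomial.aeval_X,
      Polynomial.aeval_C, rearConstants_of_add_eq ε h]
    linear_combination -hrow

theorem platoonLaplacian_mulVec_trailingContinuant (n : ℕ) (ε : Fin (n + 1) → ℝ) (x : S)
    (i : Fin n) :
    ((platoonLaplacian n ε).map (algebraMap ℝ S) *ᵥ fun j =>
      Polynomial.aeval x (trailingContinuant (rearConstants n ε) (n - j))) i.succ =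
      x * Polynomial.aeval x (trailingContinuant (rearConstants n ε) (n - i.succ)) := by
  obtain ⟨i, hi⟩ := i
  obtain rfl | ⟨k, hk⟩ : n = i + 1 ∨ ∃ k, i + (k + 2) = n := by
    obtain h | h := (Nat.succ_le_of_lt hi).eq_or_lt
    · exact .inl h.symm
    · exact .inr ⟨n - (i + 2), by lia⟩
  · have hi : (⟨i, hi⟩ : Fin (i + 1)).succ = Fin.last (i + 1) := rfl
    rw [hi, platoonLaplacian_mulVec_last]
    simp [trailingContinuant]
  · rw [Fin.succ_mk, platoonLaplacian_mulVec_interior _ (by lia)]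
    have h0 : n - i = k + 2 := by lia
    have h1 : n - (i + 1) = k + 1 := by lia
    have h2 : n - (i + 2) = k := by lia
    simp only [h0, h1, h2, trailingContinuant, map_sub, map_add, map_mul, map_one,
      Polynomial.aeval_X, Polynomial.aeval_C, rearConstants_of_add_eq ε hk]
    ring

theorem hasEigenvalue_platoonLaplacian_iff {μ : ℝ} (hμ : μ ≠ 0) :
    Module.End.HasEigenvalue (toLin' (platoonLaplacian n ε)) μ ↔
      (trailingContinuant (rearConstants n ε) n).IsRoot μ := by
  have hmap : (platoonLaplacian n ε).map (algebraMap ℝ ℝ) = platoonLaplacian n ε := map_id _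
  constructor
  · intro h
    obtain ⟨v, hv⟩ := h.exists_hasEigenvector
    have hrow (i) : ((platoonLaplacian n ε).map (algebraMap ℝ ℝ) *ᵥ v) i = μ * v i := by
      rw [hmap, ← toLin'_apply, hv.apply_eq_smul, Pi.smul_apply, smul_eq_mul]
    have hv0 : v 0 = 0 :=
      (mul_eq_zero.1 ((hrow 0).symm.trans (platoonLaplacian_mulVec_zero v))).resolve_left hμ
    have hmode {i k : ℕ} (hik : i + k = n) :=
      eq_aeval_trailingContinuant_mul_last (fun i => hrow i.succ) hik
    have hlast : v (Fin.last n) ≠ 0 := fun hlast => hv.2 <| funext fun i => by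
      simpa [hlast] using hmode (i := i) (k := n - i) (by lia)
    have hprod := (hmode (zero_add n)).symm.trans hv0
    simpa [hlast] using hprod
  · intro h
    refine Module.End.hasEigenvalue_of_hasEigenvector (x := fun j =>
      (trailingContinuant (rearConstants n ε) (n - j)).eval μ) ⟨?_, fun h0 => ?_⟩
    · rw [Module.End.mem_eigenspace_iff, toLin'_apply, ← hmap]
      ext i
      induction i using Fin.cases with
      | zero => rw [platoonLaplacian_mulVec_zero]; simp [h.eq_zero]
      | succ i => exact platoonLaplacian_mulVec_trailingContinuant n ε μ i
    · simpa [trailingContinuant] using congrFun h0 (Fin.last n)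

theorem eigenvalue_platoonLaplacian_pos (hε : ∀ i, 0 ≤ ε i) {μ : ℝ} (hμ : μ ≠ 0)
    (h : Module.End.HasEigenvalue (toLin' (platoonLaplacian n ε)) μ) : 0 < μ := by
  by_contra! hneg
  have hone := one_le_eval_trailingContinuant (e := rearConstants n ε) (fun _ => hε _) hneg n
  rw [((hasEigenvalue_platoonLaplacian_iff hμ).1 h).eq_zero] at hone
  exact hone.not_gt one_pos

theorem exists_hasEigenvalue_platoonLaplacian_mem_Ioc (hn : 1 ≤ n) (hε : ∀ i, 0 ≤ ε i) :
    ∃ μ ∈ Set.Ioc (0 : ℝ) 1,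
      Module.End.HasEigenvalue (toLin' (platoonLaplacian n ε)) μ := by
  obtain ⟨μ, hμ, hroot⟩ :=
    exists_isRoot_trailingContinuant (e := rearConstants n ε) (fun _ => hε _) (n - 1)
  rw [Nat.sub_add_cancel hn] at hroot
  exact ⟨μ, hμ, (hasEigenvalue_platoonLaplacian_iff hμ.1.ne').2 hroot⟩

theorem exists_isEigenvalueLowerBound (hε : ∀ i, 0 ≤ ε i) :
    ∃ lam : ℝ, IsEigenvalueLowerBound n ε lam := by
  have hfin : {μ | Module.End.HasEigenvalue (toLin' (platoonLaplacian n ε)) μ ∧ μ ≠ 0}.Finite :=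
    (Module.End.finite_hasEigenvalue _).subset fun _ hμ => hμ.1
  have hle : ∀ᶠ lam in nhdsWithin (0 : ℝ) (Set.Ioi 0),
      ∀ μ ∈ {μ | Module.End.HasEigenvalue (toLin' (platoonLaplacian n ε)) μ ∧ μ ≠ 0}, lam ≤ μ :=
    (Filter.eventually_all_finite hfin).2 fun μ hμ =>
      (eventually_le_nhds (eigenvalue_platoonLaplacian_pos hε hμ.2 hμ.1)).filter_mono
        nhdsWithin_le_nhds
  obtain ⟨lam, hpos, hlam⟩ := (eventually_mem_nhdsWithin.and hle).exists
  exact ⟨lam, hpos, fun μ hμ hμ0 => hlam μ ⟨hμ, hμ0⟩⟩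

end LaplacianSpectrum

section Platoon

open Matrix

variable {R K : RatFunc ℝ} {n : ℕ} {ε : Fin (n + 1) → ℝ}

theorem dvd_det_of_mulVec_eq_smul {ι A : Type*} [Fintype ι] [DecidableEq ι] [CommRing A]
    {M : Matrix ι ι A} {w : ι → A} {c : A} (h : M *ᵥ w = c • w) {i : ι} (hi : IsUnit (w i)) :
    c ∣ M.det := by
  have hadj : M.det * w i = c * (M.adjugate *ᵥ w) i := by
    simpa [adjugate_mul, smul_mulVec, mulVec_smul] using congrFun (congrArg (M.adjugate *ᵥ ·) h) i
  exact hi.dvd_mul_right.1 ⟨_, hadj⟩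

theorem hasEigenvalue_reducedLaplacian {μ : ℝ} (hμ : μ ≠ 0)
    (h : Module.End.HasEigenvalue (toLin' (platoonLaplacian n ε)) μ) :
    Module.End.HasEigenvalue (toLin' (reducedLaplacian n ε)) μ := by
  obtain ⟨v, hv⟩ := h.exists_hasEigenvector
  have hrow (i) : (platoonLaplacian n ε *ᵥ v) i = μ * v i := by
    rw [← toLin'_apply, hv.apply_eq_smul, Pi.smul_apply, smul_eq_mul]
  have hv0 : v 0 = 0 := by simpa [mulVec, platoonLaplacian_zero, hμ] using (hrow 0).symm
  refine Module.End.hasEigenvalue_of_hasEigenvector (x := fun i => v i.succ) ⟨?_, fun h0 => ?_⟩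
  · rw [Module.End.mem_eigenspace_iff, toLin'_apply]
    ext i
    simpa [reducedLaplacian, mulVec, dotProduct, Fin.sum_univ_succ, hv0] using hrow i.succ
  · refine hv.2 (funext fun i => ?_)
    induction i using Fin.cases with
    | zero => exact hv0
    | succ i => exact congrFun h0 i

theorem add_smul_dvd_platoonCharpoly (R K : RatFunc ℝ) {μ : ℝ}
    (h : Module.End.HasEigenvalue (toLin' (reducedLaplacian n ε)) μ) :
    R.denom * K.denom + μ • (R.num * K.num) ∣ platoonCharpoly R K n ε := by
  obtain ⟨w, hw⟩ := h.exists_hasEigenvector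
  obtain ⟨i, hi⟩ := Function.ne_iff.1 hw.2
  have hmap : (reducedLaplacian n ε).map Polynomial.C *ᵥ (Polynomial.C ∘ w) =
      μ • (Polynomial.C ∘ w) := by
    ext1 j
    rw [← RingHom.map_mulVec, ← toLin'_apply, hw.apply_eq_smul]
    simp [Polynomial.smul_eq_C_mul]
  refine dvd_det_of_mulVec_eq_smul (w := Polynomial.C ∘ w) ?_
    (i := i) (Polynomial.isUnit_C.2 (isUnit_iff_ne_zero.2 hi))
  rw [add_mulVec, smul_mulVec, smul_mulVec, one_mulVec, hmap, smul_comm, add_smul, smul_assoc]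

theorem PlatoonStable.isHurwitz_add_smul (h : PlatoonStable R K n ε) {μ : ℝ} (hμ : μ ≠ 0)
    (heig : Module.End.HasEigenvalue (toLin' (platoonLaplacian n ε)) μ) :
    IsHurwitz (R.denom * K.denom + μ • (R.num * K.num)) :=
  IsHurwitz.of_dvd h (add_smul_dvd_platoonCharpoly R K (hasEigenvalue_reducedLaplacian hμ heig))

theorem platoonCharpoly_predecessor (R K : RatFunc ℝ) (n : ℕ) :
    platoonCharpoly R K n (fun _ => 0) = (R.denom * K.denom + R.num * K.num) ^ n := by
  rw [platoonCharpoly, det_of_isLowerTriangular]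
  · simp [reducedLaplacian, platoonLaplacian]
  · intro i j hij
    have hlt : i < j := hij
    have hne : (j : ℕ) + 1 ≠ i := by lia
    simp [reducedLaplacian, platoonLaplacian, hlt.ne, hlt.ne', hne]

theorem det_one_add_smul_platoonLaplacian {S : Type*} [CommRing S] [Algebra ℝ S] (c : S) (n : ℕ)
    (ε : Fin (n + 1) → ℝ) :
    (1 + c • (platoonLaplacian n ε).map (algebraMap ℝ S)).det =
      (1 + c • (reducedLaplacian n ε).map (algebraMap ℝ S)).det := by
  rw [det_succ_row_zero, Fin.sum_univ_succ, Finset.sum_eq_zero fun j _ => by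
    simp [platoonLaplacian_zero, one_apply, (Fin.succ_ne_zero j).symm]]
  have hminor : (1 + c • (platoonLaplacian n ε).map (algebraMap ℝ S)).submatrix Fin.succ
      Fin.succ = 1 + c • (reducedLaplacian n ε).map (algebraMap ℝ S) := by
    ext i j
    simp [reducedLaplacian, one_apply]
  simp [hminor, platoonLaplacian_zero]

theorem algebraMap_platoonCharpoly (R K : RatFunc ℝ) (n : ℕ) (ε : Fin (n + 1) → ℝ) :
    algebraMap ℝ[X] (RatFunc ℝ) (platoonCharpoly R K n ε) =
      algebraMap ℝ[X] (RatFunc ℝ) (R.denom * K.denom) ^ n *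
        (1 + (R * K) • (platoonLaplacian n ε).map (algebraMap ℝ (RatFunc ℝ))).det := by
  have hdenom : algebraMap ℝ[X] (RatFunc ℝ) (R.denom * K.denom) ≠ 0 :=
    RatFunc.algebraMap_ne_zero (mul_ne_zero R.denom_ne_zero K.denom_ne_zero)
  have hscale : algebraMap ℝ[X] (RatFunc ℝ) (R.denom * K.denom) * (R * K) =
      algebraMap ℝ[X] (RatFunc ℝ) (R.num * K.num) := by
    rw [mul_eq_num_mul_num_div R K, mul_div_cancel₀ _ hdenom]
  have hsmul := det_smul (1 + (R * K) • (reducedLaplacian n ε).map (algebraMap ℝ (RatFunc ℝ)))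
    (algebraMap ℝ[X] (RatFunc ℝ) (R.denom * K.denom))
  rw [Fintype.card_fin] at hsmul
  rw [det_one_add_smul_platoonLaplacian, ← hsmul, smul_add, smul_smul, hscale, platoonCharpoly,
    RingHom.map_det]
  congr 1
  ext i j
  simp [one_apply, apply_ite (algebraMap ℝ[X] (RatFunc ℝ))]

theorem PlatoonStable.isUnit_det (h : PlatoonStable R K n ε) :
    IsUnit (1 + (R * K) • (platoonLaplacian n ε).map (algebraMap ℝ (RatFunc ℝ))).det := by
  have hne := RatFunc.algebraMap_ne_zero (IsHurwitz.ne_zero h)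
  rw [algebraMap_platoonCharpoly] at hne
  exact isUnit_iff_ne_zero.2 (right_ne_zero_of_mul hne)

theorem transferMatrix_add_mul_mulVec
    (hdet : IsUnit (1 + (R * K) • (platoonLaplacian n ε).map (algebraMap ℝ (RatFunc ℝ))).det)
    (i c : Fin (n + 1)) :
    transferMatrix R K n ε i c +
        R * K * ((platoonLaplacian n ε).map (algebraMap ℝ (RatFunc ℝ)) *ᵥ
          fun j => transferMatrix R K n ε j c) i =
      if i = c then R * K else 0 := by
  have hinv : (1 + (R * K) • (platoonLaplacian n ε).map (algebraMap ℝ (RatFunc ℝ))) *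
      transferMatrix R K n ε = (R * K) • 1 := by
    rw [transferMatrix, Matrix.mul_smul, mul_nonsing_inv _ hdet]
  have hentry := congrFun (congrFun hinv i) c
  rw [Matrix.add_mul, Matrix.one_mul, Matrix.smul_mul] at hentry
  simpa only [Matrix.add_apply, Matrix.smul_apply, one_apply, smul_eq_mul, mul_ite, mul_one,
    mul_zero] using! hentry

theorem transferMatrix_last_div {m : ℕ} {ε : Fin (m + 2) → ℝ}
    (hdet : IsUnit
      (1 + (R * K) • (platoonLaplacian (m + 1) ε).map (algebraMap ℝ (RatFunc ℝ))).det)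
    (hloop : closedLoop (R * K) ≠ 0) :
    transferMatrix R K (m + 1) ε (Fin.last (m + 1)) 0 /
      transferMatrix R K (m + 1) ε (Fin.last m).castSucc 0 = closedLoop (R * K) := by
  obtain ⟨hM, hM1⟩ := div_ne_zero_iff.1 hloop
  have hrow := fun i => transferMatrix_add_mul_mulVec hdet i 0
  set y := fun i => transferMatrix R K (m + 1) ε i 0
  have hlast : (1 + R * K) * y (Fin.last (m + 1)) = R * K * y (Fin.last m).castSucc := by
    have h := hrow (Fin.last (m + 1))
    rw [platoonLaplacian_mulVec_last, if_neg (Fin.last_pos).ne'] at h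
    linear_combination h
  have hprev : y (Fin.last m).castSucc ≠ 0 := by
    intro hprev
    have hlast0 : y (Fin.last (m + 1)) = 0 := by simpa [hprev, hM1] using hlast
    have hfollow (i : Fin (m + 1)) :
        ((platoonLaplacian (m + 1) ε).map (algebraMap ℝ (RatFunc ℝ)) *ᵥ y) i.succ =
          -(R * K)⁻¹ * y i.succ := by
      have h := hrow i.succ
      rw [if_neg (Fin.succ_ne_zero i)] at h
      rw [neg_mul, ← mul_neg, eq_inv_mul_iff_mul_eq₀ hM]
      linear_combination h
    have hlead : y 0 = 0 := by
      simpa [hlast0] using eq_aeval_trailingContinuant_mul_last hfollow (zero_add _)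
    have h := hrow 0
    rw [platoonLaplacian_mulVec_zero, if_pos rfl, mul_zero, add_zero] at h
    exact hM (h.symm.trans hlead)
  rw [closedLoop, div_eq_div_iff hprev hM1]
  linear_combination hlast

theorem achievesPredecessorFollowing_of_isHurwitz (hint : 1 ≤ numIntegrators (R * K))
    (h : IsHurwitz (R.denom * K.denom + R.num * K.num))
    (haxis : ∀ ω : ℝ, ‖Polynomial.aeval ((ω : ℂ) * Complex.I) (R.num * K.num)‖ ≤
      ‖Polynomial.aeval ((ω : ℂ) * Complex.I) (R.denom * K.denom + R.num * K.num)‖) :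
    AchievesPredecessorFollowing R K := by
  refine ⟨fun m => ?_, le_antisymm ?_ (one_le_hinfNorm_closedLoop hint)⟩
  · rw [PlatoonStable, platoonCharpoly_predecessor]
    exact h.pow m
  · rw [closedLoop_mul]
    exact hinfNorm_div_le_one (fun ω h0 => by simpa using h _ h0) haxis

theorem norm_aeval_axis_le_of_hinfNorm_closedLoop_le_one (hloop0 : closedLoop (R * K) ≠ 0)
    (hloop : hinfNorm (closedLoop (R * K)) ≤ 1) {t : ℝ} (ht0 : 0 ≤ t) (ht1 : t ≤ 1) (ω : ℝ) :
    ‖Polynomial.aeval ((ω : ℂ) * Complex.I) (t • (R.num * K.num))‖ ≤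
      ‖Polynomial.aeval ((ω : ℂ) * Complex.I) (R.denom * K.denom + t • (R.num * K.num))‖ := by
  rw [closedLoop_mul] at hloop0 hloop
  have hne : R.denom * K.denom + R.num * K.num ≠ 0 := by
    intro h0
    simp [h0] at hloop0
  have haxis := norm_aeval_axis_le_of_hinfNorm_div_le_one hne hloop ω
  rw [map_smul, map_add, map_smul]
  exact norm_smul_le_norm_add_smul ht0 ht1 (by simpa only [one_smul, map_add] using haxis)

theorem achievesPredecessorFollowing_C_mul (hint : 1 ≤ numIntegrators (R * K))
    (hloop : hinfNorm (closedLoop (R * K)) ≤ 1) {μ lam : ℝ} (hμ : μ ≤ 1)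
    (hmode : IsHurwitz (R.denom * K.denom + μ • (R.num * K.num)))
    (hlam : 0 < lam) (hle : lam ≤ μ) :
    AchievesPredecessorFollowing R (RatFunc.C lam * K) := by
  have haxis {t : ℝ} (ht0 : 0 < t) (ht1 : t ≤ 1) := norm_aeval_axis_le_of_hinfNorm_closedLoop_le_one
    (closedLoop_ne_zero hint) hloop ht0.le ht1
  have hden : R.denom * (RatFunc.C lam * K).denom = R.denom * K.denom := by
    rw [denom_C_mul K hlam.ne']
  have hnum : R.num * (RatFunc.C lam * K).num = lam • (R.num * K.num) := by
    rw [num_C_mul K hlam.ne', mul_smul_comm]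
  refine achievesPredecessorFollowing_of_isHurwitz ?_ ?_ ?_
  · rwa [mul_left_comm, numIntegrators_C_mul _ hlam.ne']
  · rw [hden, hnum]
    exact hmode.add_smul_of_le hlam hle (haxis (hlam.trans_le hle) hμ)
  · rw [hden, hnum]
    exact haxis hlam (hle.trans hμ)

end Platoon

theorem mainTheorem5 (R K : RatFunc ℝ) (n : ℕ) (hn : 1 ≤ n) (ε : Fin (n + 1) → ℝ)
    (hε : ∀ i, 0 ≤ ε i)
    (hint : 1 ≤ numIntegrators (R * K))
    (hstable : PlatoonStable R K n ε)
    (hstring : BidirectionallyStringStable R K n ε) :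
    (∃ K' : RatFunc ℝ, AchievesPredecessorFollowing R K') ∧
    (∃ lam : ℝ, IsEigenvalueLowerBound n ε lam) ∧
    (∀ lam : ℝ, IsEigenvalueLowerBound n ε lam →
      AchievesPredecessorFollowing R (RatFunc.C lam * K)) := by
  have hloop : hinfNorm (closedLoop (R * K)) ≤ 1 := by
    obtain ⟨m, rfl⟩ := Nat.exists_eq_add_of_le' hn
    rw [← transferMatrix_last_div hstable.isUnit_det (closedLoop_ne_zero hint)]
    exact (hstring 0 (Fin.last m)).1 (Fin.succ_pos _)
  obtain ⟨μ, ⟨hμ0, hμ1⟩, hμ⟩ := exists_hasEigenvalue_platoonLaplacian_mem_Ioc hn hε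
  have hscaled (lam : ℝ) (hlam : IsEigenvalueLowerBound n ε lam) :
      AchievesPredecessorFollowing R (RatFunc.C lam * K) :=
    achievesPredecessorFollowing_C_mul hint hloop hμ1 (hstable.isHurwitz_add_smul hμ0.ne' hμ)
      hlam.1 (hlam.2 μ hμ hμ0.ne')
  obtain ⟨lam, hlam⟩ := exists_isEigenvalueLowerBound hε
  exact ⟨⟨_, hscaled lam hlam⟩, ⟨lam, hlam⟩, hscaled⟩
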